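/- Let $\rho_1,\rho_2,q\in\mathbb R$ with $0<|\rho_1|<1$, $|\rho_2|<1$, $|q|<1$. Write $[n]_q=1+q+\dots+q^{n-1}$ (with $[0]_q=0$), $[n]_q!=\prod_{j=1}^n[j]_q$, $(a)_n=\prod_{j=0}^{n-1}(1-aq^j)$, $(a)_\infty=\prod_{j\ge 0}(1-aq^j)$, $S(q)=[-2/\sqrt{1-q},\,2/\sqrt{1-q}]$, $$W_q(x,y|t)=(1-t^2)^2-(1-q)xyt(1+t^2)+(1-q)t^2(x^2+y^2),$$ and, for every real $\rho$, let the (rescaled) Al-Salam--Chihara polynomials $P_n(x|y,\rho,q)$ be defined by $P_0=1$, $P_1(x|y,\rho,q)=x-\rho y$ and, for $n\ge 1$, $$P_{n+1}(x|y,\rho,q)=(x-\rho yq^n)P_n(x|y,\rho,q)-(1-\rho^2q^{n-1})[n]_qP_{n-1}(x|y,\rho,q).$$ Then for all $x,y,z\in S(q)$ the series and the infinite products below converge (the series and the product over $k$ unconditionally), and $$0\le\sum_{n\ge 0}\frac{\rho_1^n}{[n]_q!\,(\rho_2^2)_n}P_n(x|y,\rho_2,q)\,P_n\!\left(z\,\Big|\,y,\frac{\rho_2}{\rho_1},q\right)=\frac{(\rho_1^2)_\infty}{(\rho_2^2)_\infty}\prod_{k=0}^\infty\frac{W_q(x,y|\rho_2q^k)}{W_q(x,z|\rho_1q^k)}.$$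 -/

import Mathlib

noncomputable section

/-- The `q`-number `[n]_q = 1 + q + ⋯ + q^(n-1)`. -/
def qNumber (q : ℝ) (n : ℕ) : ℝ := ∑ i ∈ Finset.range n, q ^ i

/-- The `q`-factorial `[n]_q! = [1]_q [2]_q ⋯ [n]_q`. -/
def qFactorial (q : ℝ) (n : ℕ) : ℝ := ∏ j ∈ Finset.range n, qNumber q (j + 1)

/-- The finite `q`-Pochhammer symbol `(a; q)_n = ∏_{j < n} (1 - a q^j)`. -/
def qPochhammer (a q : ℝ) (n : ℕ) : ℝ := ∏ j ∈ Finset.range n, (1 - a * q ^ j)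

/-- The infinite `q`-Pochhammer symbol `(a; q)_∞ = ∏_{j ≥ 0} (1 - a q^j)`, used for `|q| < 1`. -/
def qPochhammerInf (a q : ℝ) : ℝ := ∏' j : ℕ, (1 - a * q ^ j)

/-- The product defining `(a; q)_∞` converges when `|q| < 1`. -/
theorem multipliable_qPochhammerInf (a q : ℝ) (hq : |q| < 1) :
    Multipliable (fun j : ℕ => 1 - a * q ^ j) := by
  have h : Summable (fun j : ℕ => -(a * q ^ j)) :=
    ((summable_geometric_of_abs_lt_one hq).mul_left a).neg
  simpa [sub_eq_add_neg] using Real.multipliable_one_add_of_summable h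

/-- The interval `S(q) = [-2/√(1-q), 2/√(1-q)]`. -/
def supportInterval (q : ℝ) : Set ℝ := Set.Icc (-(2 / √(1 - q))) (2 / √(1 - q))

/-- `W_q(x, y | t) = (1 - t²)² - (1-q) x y t (1 + t²) + (1-q) t² (x² + y²)`. -/
def kernelW (q x y t : ℝ) : ℝ :=
  (1 - t ^ 2) ^ 2 - (1 - q) * x * y * t * (1 + t ^ 2) + (1 - q) * t ^ 2 * (x ^ 2 + y ^ 2)

/-- The (rescaled, monic) Al-Salam–Chihara polynomials `P_n(x | y, ρ, q)`, for all real `ρ`: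
`P_{n+1} = (x - ρ y q^n) P_n - (1 - ρ² q^(n-1)) [n]_q P_{n-1}`, `P_{-1} = 0`, `P_0 = 1`. -/
def ascP (x y ρ q : ℝ) : ℕ → ℝ
  | 0 => 1
  | 1 => x - ρ * y
  | n + 2 => (x - ρ * y * q ^ (n + 1)) * ascP x y ρ q (n + 1)
      - (1 - ρ ^ 2 * q ^ n) * qNumber q (n + 1) * ascP x y ρ q n

/-- The `n`-th term
`ρ₁^n / ([n]_q! (ρ₂²; q)_n) * P_n(x | y, ρ₂, q) * P_n(z | y, ρ₂/ρ₁, q)`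
of the non-symmetric Al-Salam–Chihara kernel. -/
def ascKernelTerm (ρ₁ ρ₂ q x y z : ℝ) (n : ℕ) : ℝ :=
  ρ₁ ^ n / (qFactorial q n * qPochhammer (ρ₂ ^ 2) q n) *
    ascP x y ρ₂ q n * ascP z y (ρ₂ / ρ₁) q n

end

open Filter Topology

/-! Fix ρ₁ and let F(ρ) be the series with ρ in place of ρ₂. Two connection formulas between the
parameters ρ and ρq, `ascP_eq_shift` and `kernelW_mul_ascP_shift`, are adjoint once the polynomials
are divided by their norms. Expanding the z-polynomials by the first and regrouping by the second
gives (1-ρ²)(1-ρ²q) F(ρ) = W(x,y|ρ) F(ρq) (`ascKernel_shift`). Iterating and letting ρq^N → 0 yields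
(ρ²)_∞ F(ρ) = ∏ W(x,y|ρq^k) · F(0).

The constant F(0), the q-Hermite Mehler kernel, does not depend on y. Taking y = z and ρ = ρ₁ leaves
only the term n = 0, since P_n(z|z,1) = 0 for n ≥ 1; hence F(0) = (ρ₁²)_∞ / ∏ W(x,z|ρ₁q^k), and
division gives the formula.

Regrouping and the limit rest on a geometric bound uniform in ρ (`exists_ascKernel_bound`), obtained
by comparison with the Chebyshev recurrence. Nonnegativity follows from W ≥ 0 (`kernelW_ge`). -/

/-! ### Recurrences and connection formulas. -/

theorem one_sub_mul_qNumber (q : ℝ) (n : ℕ) : (1 - q) * qNumber q n = 1 - q ^ n :=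
  mul_neg_geom_sum q n

theorem qNumber_eq_div {q : ℝ} (hq : q ≠ 1) (n : ℕ) : qNumber q n = (1 - q ^ n) / (1 - q) := by
  rw [eq_div_iff (sub_ne_zero.2 hq.symm), mul_comm, one_sub_mul_qNumber]

theorem ascP_succ_succ (x y ρ q : ℝ) (n : ℕ) :
    ascP x y ρ q (n + 2) = (x - ρ * y * q ^ (n + 1)) * ascP x y ρ q (n + 1)
      - (1 - ρ ^ 2 * q ^ n) * qNumber q (n + 1) * ascP x y ρ q n := by
  rw [ascP]

/-- Connection formula between the parameters `ρ` and `ρ q`. -/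
theorem ascP_eq_shift (x y ρ q : ℝ) (hq : q ≠ 1) (n : ℕ) :
    ascP x y ρ q (n + 2) = ascP x y (ρ * q) q (n + 2)
      - ρ * (1 - q) * y * qNumber q (n + 2) * ascP x y (ρ * q) q (n + 1)
      + ρ ^ 2 * (1 - q) * qNumber q (n + 2) * qNumber q (n + 1) * ascP x y (ρ * q) q n := by
  have h1 : 1 - q ≠ 0 := sub_ne_zero.2 hq.symm
  induction n using Nat.twoStepInduction with
  | zero =>
    simp [ascP, qNumber, Finset.sum_range_succ]
    ring
  | one =>
    simp [ascP, qNumber, Finset.sum_range_succ]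
    ring
  | more n ih0 ih1 =>
    rw [ascP_succ_succ x y ρ q (n + 2), ih1, ih0, ascP_succ_succ x y (ρ * q) q (n + 2),
      ascP_succ_succ x y (ρ * q) q (n + 1), ascP_succ_succ x y (ρ * q) q n]
    simp only [qNumber_eq_div hq]
    field_simp
    ring

/-- Dual connection formula: multiplication by `W` maps parameter `ρ q` to `ρ`. -/
theorem kernelW_mul_ascP_shift (x y ρ q : ℝ) (hq : q ≠ 1) (n : ℕ) :
    kernelW q x y ρ * ascP x y (ρ * q) q n =
      (1 - ρ ^ 2 * q ^ n) * (1 - ρ ^ 2 * q ^ (n + 1)) * ascP x y ρ q n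
      - ρ * (1 - q) * y * (1 - ρ ^ 2 * q ^ (n + 1)) * ascP x y ρ q (n + 1)
      + ρ ^ 2 * (1 - q) * ascP x y ρ q (n + 2) := by
  have h1 : 1 - q ≠ 0 := sub_ne_zero.2 hq.symm
  induction n using Nat.twoStepInduction with
  | zero =>
    simp [ascP, qNumber, kernelW]
    ring
  | one =>
    simp [ascP, qNumber, kernelW, Finset.sum_range_succ]
    ring
  | more n ih0 ih1 =>
    rw [ascP_succ_succ x y (ρ * q) q n]
    have : kernelW q x y ρ * ((x - ρ * q * y * q ^ (n + 1)) * ascP x y (ρ * q) q (n + 1) -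
        (1 - (ρ * q) ^ 2 * q ^ n) * qNumber q (n + 1) * ascP x y (ρ * q) q n) =
      (x - ρ * q * y * q ^ (n + 1)) * (kernelW q x y ρ * ascP x y (ρ * q) q (n + 1)) -
        (1 - (ρ * q) ^ 2 * q ^ n) * qNumber q (n + 1) * (kernelW q x y ρ * ascP x y (ρ * q) q n) := by
      ring
    rw [this, ih0, ih1, ascP_succ_succ x y ρ q (n + 2),
      ascP_succ_succ x y ρ q (n + 1), ascP_succ_succ x y ρ q n]
    simp only [qNumber_eq_div hq]
    field_simp
    ring

/-- At ρ = 1 the coefficient 1 - ρ²q⁰ removes P₀ from P₂, so P₁ = P₂ = 0 and the recurrence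
propagates zero. This collapses the series at ρ = ρ₁, y = z. -/
theorem ascP_self_one (z q : ℝ) (n : ℕ) : ascP z z 1 q (n + 1) = 0 := by
  induction n using Nat.twoStepInduction with
  | zero => simp [ascP]
  | one => simp [ascP]
  | more n ih0 ih1 => rw [ascP_succ_succ, ih1, ih0]; simp

theorem ascP_zero_param (x y y' q : ℝ) (n : ℕ) : ascP x y 0 q n = ascP x y' 0 q n := by
  induction n using Nat.twoStepInduction with
  | zero => rfl
  | one => simp [ascP]
  | more n ih0 ih1 => rw [ascP_succ_succ, ascP_succ_succ, ih1, ih0]; simp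

theorem continuous_ascP (x y q : ℝ) (n : ℕ) : Continuous fun ρ => ascP x y ρ q n := by
  induction n using Nat.twoStepInduction with
  | zero => exact continuous_const
  | one => simp only [ascP]; fun_prop
  | more n ih0 ih1 => simp only [ascP_succ_succ]; fun_prop

theorem qPochhammer_add_two (a q : ℝ) (n : ℕ) :
    qPochhammer a q (n + 2) = (1 - a) * (1 - a * q) * qPochhammer (a * q ^ 2) q n := by
  simp only [qPochhammer, Finset.prod_range_succ']
  simp only [pow_add, mul_assoc]
  ring_nf

/-! ### Factorisation and positivity of W. -/

/-- With a = cos θ and b = cos φ, the factors are 1 + t² - 2t cos(θ ± φ). -/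
theorem kernelW_factor (q x y t a b : ℝ) (hx : (1 - q) * x ^ 2 = 4 * a ^ 2)
    (hy : (1 - q) * y ^ 2 = 4 * b ^ 2) (hxy : (1 - q) * (x * y) = 4 * (a * b))
    (ha : a ^ 2 ≤ 1) (hb : b ^ 2 ≤ 1) :
    kernelW q x y t = (1 + t ^ 2 - 2 * t * (a * b - √(1 - a ^ 2) * √(1 - b ^ 2))) *
      (1 + t ^ 2 - 2 * t * (a * b + √(1 - a ^ 2) * √(1 - b ^ 2))) := by
  have h1 := Real.sq_sqrt (sub_nonneg.2 ha)
  have h2 := Real.sq_sqrt (sub_nonneg.2 hb)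
  have : kernelW q x y t = (1 - t ^ 2) ^ 2 - ((1 - q) * (x * y)) * t * (1 + t ^ 2)
      + t ^ 2 * ((1 - q) * x ^ 2 + (1 - q) * y ^ 2) := by rw [kernelW]; ring
  rw [this, hx, hy, hxy]
  generalize √(1 - a ^ 2) = s at *
  generalize √(1 - b ^ 2) = u at *
  have h3 : s ^ 2 * u ^ 2 = (1 - a ^ 2) * (1 - b ^ 2) := by rw [h1, h2]
  linear_combination (-4 * t ^ 2) * (-h3)

theorem sq_cos_param_le_one {q x : ℝ} (hq : |q| < 1) (hx : x ∈ supportInterval q) :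
    (√(1 - q) * x / 2) ^ 2 ≤ 1 := by
  have hs : 0 < √(1 - q) := Real.sqrt_pos.2 (by linarith [(abs_lt.1 hq).2])
  obtain ⟨h1, h2⟩ := hx
  have h3 : √(1 - q) * x ≤ 2 := by
    have := mul_le_mul_of_nonneg_left h2 hs.le
    rwa [mul_div_cancel₀ _ hs.ne'] at this
  have h4 : -2 ≤ √(1 - q) * x := by
    have := mul_le_mul_of_nonneg_left h1 hs.le
    rwa [mul_neg, mul_div_cancel₀ _ hs.ne'] at this
  rw [sq_le_one_iff_abs_le_one, abs_le]
  constructor <;> linarith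

theorem kernelW_ge {q x y t : ℝ} (hq : |q| < 1) (hx : x ∈ supportInterval q)
    (hy : y ∈ supportInterval q) : (1 - |t|) ^ 4 ≤ kernelW q x y t := by
  have hs := Real.sq_sqrt (show 0 ≤ 1 - q by linarith [(abs_lt.1 hq).2])
  have ha := sq_cos_param_le_one hq hx
  have hb := sq_cos_param_le_one hq hy
  rw [kernelW_factor q x y t (√(1 - q) * x / 2) (√(1 - q) * y / 2)
    (by linear_combination (-x ^ 2) * hs) (by linear_combination (-y ^ 2) * hs)
    (by linear_combination (-x * y) * hs) ha hb]
  generalize √(1 - q) * x / 2 = a at *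
  generalize √(1 - q) * y / 2 = b at *
  have h1 := Real.sq_sqrt (sub_nonneg.2 ha)
  have h2 := Real.sq_sqrt (sub_nonneg.2 hb)
  generalize √(1 - a ^ 2) = s at *
  generalize √(1 - b ^ 2) = u at *
  have key : ∀ c : ℝ, c ^ 2 ≤ 1 → (1 - |t|) ^ 2 ≤ 1 + t ^ 2 - 2 * t * c := by
    intro c hc
    have h5 : |c| ≤ 1 := (sq_le_one_iff_abs_le_one c).1 hc
    have h6 : t * c ≤ |t| := by
      calc t * c ≤ |t * c| := le_abs_self _
        _ = |t| * |c| := abs_mul _ _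
        _ ≤ |t| * 1 := by gcongr
        _ = |t| := mul_one _
    nlinarith [sq_abs t]
  have e1 : (a * b - s * u) ^ 2 + (a * u + s * b) ^ 2 = 1 := by
    linear_combination (b ^ 2 + u ^ 2) * h1 + h2
  have e2 : (a * b + s * u) ^ 2 + (a * u - s * b) ^ 2 = 1 := by
    linear_combination (b ^ 2 + u ^ 2) * h1 + h2
  have k1 := key (a * b - s * u) (by nlinarith [sq_nonneg (a * u + s * b)])
  have k2 := key (a * b + s * u) (by nlinarith [sq_nonneg (a * u - s * b)])
  calc (1 - |t|) ^ 4 = (1 - |t|) ^ 2 * (1 - |t|) ^ 2 := by ring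
    _ ≤ _ := mul_le_mul k1 k2 (sq_nonneg _) ((sq_nonneg _).trans k1)

/-! ### Growth of the polynomials on the support interval. -/

theorem geom_sum_le_inv {κ : ℝ} (h0 : 0 ≤ κ) (h1 : κ < 1) (n : ℕ) :
    ∑ i ∈ Finset.range n, κ ^ i ≤ (1 - κ)⁻¹ := by
  rw [← tsum_geometric_of_lt_one h0 h1]
  exact (summable_geometric_of_lt_one h0 h1).sum_le_tsum _ fun i _ => pow_nonneg h0 i

/-- Growth bound for a summable perturbation of the Chebyshev recurrence. -/
theorem perturbed_chebyshev_bound {c A κ r K : ℝ} (hc : c ^ 2 ≤ 1) (hA : 0 ≤ A) (hκ0 : 0 ≤ κ)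
    (hκ1 : κ < 1) (hr : 1 < r) (hK1 : 1 ≤ K) (hK : 1 ≤ (r - 1) * K)
    (p δ η : ℕ → ℝ) (hδ : ∀ n, |δ n| ≤ A * κ ^ n) (hη : ∀ n, |η n| ≤ A * κ ^ n)
    (hp : ∀ n, p (n + 2) = (2 * c - δ n) * p (n + 1) - (1 - η n) * p n) (n : ℕ) :
    |p (n + 1)| ≤ r ^ n * Real.exp (2 * (1 + K) * A * (1 - κ)⁻¹) *
      ((1 + K) * |p 1| + K * |p 0|) := by
  -- A unimodular root of w² - 2cw + 1; with d below, the unperturbed recurrence factors as d (n +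
  -- 1) = w̄ · d n.
  set w : ℂ := ⟨c, √(1 - c ^ 2)⟩ with hw
  have hww : w * (starRingEnd ℂ) w = 1 := by
    rw [Complex.mul_conj, Complex.normSq_mk]
    norm_cast
    rw [← sq, ← sq, Real.sq_sqrt (sub_nonneg.2 hc)]; ring
  have hw2 : w + (starRingEnd ℂ) w = ((2 * c : ℝ) : ℂ) := by
    rw [Complex.add_conj]
  have hwn : ‖w‖ = 1 := by
    have h := congrArg norm hww
    rw [norm_mul, Complex.norm_conj, norm_one] at h
    nlinarith [norm_nonneg w]
  set d : ℕ → ℂ := fun n => (p (n + 1) : ℂ) - w * p n with hd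
  have hp' : ∀ n, |p n| ≤ |p (n + 1)| + ‖d n‖ := by
    intro n
    have : w * p n = p (n + 1) - d n := by simp [hd]
    calc |p n| = ‖w * p n‖ := by rw [norm_mul, hwn, one_mul, Complex.norm_real, Real.norm_eq_abs]
      _ ≤ ‖(p (n + 1) : ℂ)‖ + ‖d n‖ := by rw [this]; exact norm_sub_le _ _
      _ = _ := by rw [Complex.norm_real, Real.norm_eq_abs]
  have hp'' : ∀ n, |p (n + 1)| ≤ |p n| + ‖d n‖ := by
    intro n
    have : (p (n + 1) : ℂ) = w * p n + d n := by simp [hd]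
    calc |p (n + 1)| = ‖(p (n + 1) : ℂ)‖ := by rw [Complex.norm_real, Real.norm_eq_abs]
      _ ≤ ‖w * p n‖ + ‖d n‖ := by rw [this]; exact norm_add_le _ _
      _ = _ := by rw [norm_mul, hwn, one_mul, Complex.norm_real, Real.norm_eq_abs]
  have hdd : ∀ n, ‖d (n + 1)‖ ≤ ‖d n‖ + A * κ ^ n * (|p (n + 1)| + |p n|) := by
    intro n
    have e : d (n + 1) = (starRingEnd ℂ) w * d n + ((η n * p n - δ n * p (n + 1) : ℝ) : ℂ) := by
      simp only [hd]
      rw [hp n]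
      push_cast at hw2 ⊢
      linear_combination (p n : ℂ) * hww - (p (n + 1) : ℂ) * hw2
    rw [e]
    refine (norm_add_le _ _).trans ?_
    rw [norm_mul, Complex.norm_conj, hwn, one_mul, Complex.norm_real, Real.norm_eq_abs]
    gcongr
    refine (abs_sub _ _).trans ?_
    rw [abs_mul, abs_mul]
    nlinarith [mul_le_mul_of_nonneg_right (hδ n) (abs_nonneg (p (n + 1))),
      mul_le_mul_of_nonneg_right (hη n) (abs_nonneg (p n))]
  -- At c = ±1 the root is double and solutions may grow linearly. The weight K, with 1 + K ≤ rK,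
  -- absorbs this into a factor r per step.
  set X : ℕ → ℝ := fun n => |p (n + 1)| + K * ‖d n‖ with hX
  set D : ℝ := 2 * (1 + K) * A with hD
  have hD0 : 0 ≤ D := by positivity
  have hX0 : ∀ n, 0 ≤ X n := fun n => by positivity
  have step : ∀ n, X (n + 1) ≤ r * Real.exp (D * κ ^ n) * X n := by
    intro n
    have h1 := hp'' (n + 1)
    have h2 := hdd n
    have h3 := hp' n
    have hκn : 0 ≤ A * κ ^ n := by positivity
    have hdn := norm_nonneg (d n)
    have hpn := abs_nonneg (p (n + 1))
    have h4 : |p (n + 1)| + |p n| ≤ 2 * X n := by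
      simp only [hX]; nlinarith
    have h5 : ‖d (n + 1)‖ ≤ ‖d n‖ + A * κ ^ n * (2 * X n) :=
      h2.trans (by gcongr)
    have h6 : X (n + 1) ≤ |p (n + 1)| + (1 + K) * (‖d n‖ + A * κ ^ n * (2 * X n)) := by
      have : (1 + K) * ‖d (n + 1)‖ ≤ (1 + K) * (‖d n‖ + A * κ ^ n * (2 * X n)) := by gcongr
      simp only [hX] at this ⊢
      linarith
    have h7 : |p (n + 1)| + (1 + K) * ‖d n‖ ≤ r * X n := by
      simp only [hX]
      nlinarith
    have h8 : X (n + 1) ≤ (r + D * κ ^ n) * X n := by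
      rw [hD]; linarith
    have h9 : r + D * κ ^ n ≤ r * Real.exp (D * κ ^ n) := by
      have h10 := Real.add_one_le_exp (D * κ ^ n)
      have : 0 ≤ D * κ ^ n := by positivity
      nlinarith
    exact h8.trans (mul_le_mul_of_nonneg_right h9 (hX0 n))
  have main : ∀ n, X n ≤ r ^ n * Real.exp (D * ∑ i ∈ Finset.range n, κ ^ i) * X 0 := by
    intro n
    induction n with
    | zero => simp
    | succ n ih =>
      calc X (n + 1) ≤ r * Real.exp (D * κ ^ n) * X n := step n
        _ ≤ r * Real.exp (D * κ ^ n) *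
            (r ^ n * Real.exp (D * ∑ i ∈ Finset.range n, κ ^ i) * X 0) := by gcongr
        _ = _ := by rw [Finset.sum_range_succ, mul_add D, Real.exp_add]; ring
  have hXp : X 0 ≤ (1 + K) * |p 1| + K * |p 0| := by
    have : ‖d 0‖ ≤ |p 1| + |p 0| := by
      refine (norm_sub_le _ _).trans ?_
      rw [norm_mul, hwn, one_mul, Complex.norm_real, Complex.norm_real, Real.norm_eq_abs,
        Real.norm_eq_abs]
    simp only [hX, zero_add]
    nlinarith
  calc |p (n + 1)| ≤ X n := by simp only [hX]; nlinarith [norm_nonneg (d n)]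
    _ ≤ r ^ n * Real.exp (D * ∑ i ∈ Finset.range n, κ ^ i) * X 0 := main n
    _ ≤ r ^ n * Real.exp (D * (1 - κ)⁻¹) * ((1 + K) * |p 1| + K * |p 0|) := by
      gcongr
      exact geom_sum_le_inv hκ0 hκ1 n

/-- Growth of the polynomials `P_n` on the support interval, locally uniformly in `ρ`. -/
theorem exists_ascP_bound {x y q M r : ℝ} (hq : |q| < 1) (hx : x ∈ supportInterval q)
    (hM : 0 ≤ M) (hr : 1 < r) :
    ∃ C, 0 ≤ C ∧ ∀ ρ, |ρ| ≤ M → ∀ n, |ascP x y ρ q n| * √(1 - q) ^ n ≤ C * r ^ n := by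
  have hs2 := Real.sq_sqrt (show 0 ≤ 1 - q by linarith [(abs_lt.1 hq).2])
  have hs0 := Real.sqrt_nonneg (1 - q)
  have hxc := sq_cos_param_le_one hq hx
  set s := √(1 - q)
  -- Large enough for both perturbations: M|y|s bounds δ, and 2M² + 1 the three terms of η in 1 - η
  -- = (1 - ρ²qⁿ)(1 - qⁿ⁺¹).
  set A := M * |y| * s + 2 * M ^ 2 + 1 with hA
  have hA0 : 0 ≤ A := by positivity
  set K := max 1 (r - 1)⁻¹ with hKdef
  have hr1 : 0 < r - 1 := by linarith
  have hK1 : 1 ≤ K := le_max_left _ _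
  have hK : 1 ≤ (r - 1) * K := by
    calc 1 = (r - 1) * (r - 1)⁻¹ := (mul_inv_cancel₀ hr1.ne').symm
      _ ≤ _ := by gcongr; exact le_max_right _ _
  set E := Real.exp (2 * (1 + K) * A * (1 - |q|)⁻¹)
  have hE : 0 < E := Real.exp_pos _
  set B := (1 + K) * ((|x| + M * |y|) * s) + K with hB
  have hB0 : 0 ≤ B := by positivity
  refine ⟨E * B + 1, by positivity, fun ρ hρ n => ?_⟩
  have hρ2 : ρ ^ 2 ≤ M ^ 2 := by rw [← sq_abs]; gcongr
  have hpow : ∀ n : ℕ, |q| ^ n ≤ 1 := fun n => pow_le_one₀ (abs_nonneg q) hq.le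
  cases n with
  | zero => simp only [ascP, abs_one, pow_zero, mul_one]; nlinarith
  | succ n =>
    have key := perturbed_chebyshev_bound hxc hA0 (abs_nonneg q) hq hr hK1 hK
      (fun n => ascP x y ρ q n * s ^ n) (fun n => ρ * y * s * q ^ (n + 1))
      (fun n => ρ ^ 2 * q ^ n + q ^ (n + 1) - ρ ^ 2 * q ^ n * q ^ (n + 1))
      (fun n => by
        rw [abs_mul, abs_mul, abs_mul, abs_of_nonneg hs0, pow_succ, abs_mul, abs_pow]
        have h1 : |ρ| * |y| * s * (|q| ^ n * |q|) ≤ M * |y| * s * (|q| ^ n * 1) := by gcongr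
        refine h1.trans ?_
        rw [mul_one]
        gcongr
        rw [hA]; nlinarith [sq_nonneg M])
      (fun n => by
        have h1 : |ρ ^ 2 * q ^ n| ≤ M ^ 2 * |q| ^ n := by
          rw [abs_mul, abs_of_nonneg (sq_nonneg ρ), abs_pow]; gcongr
        have h2 : |q ^ (n + 1)| ≤ |q| ^ n := by
          rw [abs_pow, pow_succ]; exact mul_le_of_le_one_right (by positivity) hq.le
        have h3 : |ρ ^ 2 * q ^ n * q ^ (n + 1)| ≤ M ^ 2 * |q| ^ n := by
          rw [abs_mul _ (q ^ (n + 1))]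
          exact (mul_le_of_le_one_right (abs_nonneg _) (by rw [abs_pow]; exact hpow _)).trans h1
        have h4 : |ρ ^ 2 * q ^ n + q ^ (n + 1) - ρ ^ 2 * q ^ n * q ^ (n + 1)| ≤
            |ρ ^ 2 * q ^ n| + |q ^ (n + 1)| + |ρ ^ 2 * q ^ n * q ^ (n + 1)| :=
          (abs_sub _ _).trans (add_le_add_left (abs_add_le _ _) _)
        have h5 : 0 ≤ M * |y| * s * |q| ^ n := by positivity
        rw [hA]; linarith)
      (fun n => by
        rw [ascP_succ_succ]
        have h1 := one_sub_mul_qNumber q (n + 1)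
        have h2 : s ^ 2 * qNumber q (n + 1) = 1 - q ^ (n + 1) := by rw [hs2, h1]
        linear_combination (-(1 - ρ ^ 2 * q ^ n) * ascP x y ρ q n * s ^ n) * h2) n
    have hs : |s ^ (n + 1)| = s ^ (n + 1) := abs_of_nonneg (by positivity)
    simp only [abs_mul, hs] at key
    refine key.trans ?_
    have h1 : |ascP x y ρ q 1| ≤ |x| + M * |y| := by
      simp only [ascP]
      refine (abs_sub _ _).trans ?_
      rw [abs_mul]; gcongr
    have h2 : (1 + K) * (|ascP x y ρ q 1| * |s ^ 1|) + K * (|ascP x y ρ q 0| * |s ^ 0|) ≤ B := by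
      simp only [pow_one, pow_zero, abs_one, mul_one, abs_of_nonneg hs0, ascP] at h1 ⊢
      rw [hB]; gcongr
    calc r ^ n * E * ((1 + K) * (|ascP x y ρ q 1| * |s ^ 1|) + K * (|ascP x y ρ q 0| * |s ^ 0|))
        ≤ r ^ n * E * B := by gcongr
      _ ≤ r ^ (n + 1) * (E * B + 1) := by
        rw [pow_succ]
        have : 0 < r ^ n := by positivity
        have h3 : r ^ n ≤ r ^ n * r := le_mul_of_one_le_right this.le hr.le
        have h4 : 0 ≤ E * B := by positivity
        nlinarith
      _ = _ := mul_comm _ _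

/-! ### Lower bounds for q-Pochhammer symbols and norms. -/

/-- Each factor obeys 1 - v ≥ exp(-v/(1-v)) with v = m|q|^j, and the exponents are summed
geometrically. -/
theorem exp_neg_le_qPochhammer {a q m : ℝ} (ha : |a| ≤ m) (hm : m < 1) (hq : |q| < 1) (n : ℕ) :
    Real.exp (-(m / (1 - m) * (1 - |q|)⁻¹)) ≤ qPochhammer a q n := by
  have hm0 : 0 ≤ m := (abs_nonneg a).trans ha
  have hm1 : 0 < 1 - m := by linarith
  have key : ∀ j : ℕ, Real.exp (-(m / (1 - m) * |q| ^ j)) ≤ 1 - a * q ^ j := by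
    intro j
    have h1 : |a * q ^ j| ≤ m * |q| ^ j := by rw [abs_mul, abs_pow]; gcongr
    have h2 : m * |q| ^ j ≤ m := mul_le_of_le_one_right hm0 (pow_le_one₀ (abs_nonneg q) hq.le)
    set v := m * |q| ^ j with hv
    have hv0 : 0 ≤ v := by positivity
    have hv1 : 0 < 1 - v := by linarith
    have h3 : 1 - v ≤ 1 - a * q ^ j := by linarith [le_abs_self (a * q ^ j)]
    refine le_trans ?_ h3
    rw [Real.exp_neg]
    refine inv_le_of_inv_le₀ hv1 ?_
    have h4 : v / (1 - v) ≤ m / (1 - m) * |q| ^ j := by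
      rw [div_mul_eq_mul_div, ← hv]; gcongr
    calc (1 - v)⁻¹ = v / (1 - v) + 1 := by field_simp; ring
      _ ≤ m / (1 - m) * |q| ^ j + 1 := by gcongr
      _ ≤ _ := Real.add_one_le_exp _
  calc Real.exp (-(m / (1 - m) * (1 - |q|)⁻¹))
      ≤ Real.exp (-(m / (1 - m) * ∑ j ∈ Finset.range n, |q| ^ j)) := by
        have := geom_sum_le_inv (abs_nonneg q) hq n
        gcongr
    _ = ∏ j ∈ Finset.range n, Real.exp (-(m / (1 - m) * |q| ^ j)) := by
        rw [← Real.exp_sum, Finset.sum_neg_distrib, Finset.mul_sum]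
    _ ≤ _ := Finset.prod_le_prod (fun _ _ => (Real.exp_pos _).le) fun j _ => key j

theorem qFactorial_mul_pow (q : ℝ) (n : ℕ) :
    qFactorial q n * (1 - q) ^ n = qPochhammer q q n := by
  rw [qFactorial, qPochhammer, ← Finset.card_range n, ← Finset.prod_const, Finset.card_range,
    ← Finset.prod_mul_distrib]
  refine Finset.prod_congr rfl fun j _ => ?_
  rw [mul_comm, one_sub_mul_qNumber, pow_succ']

/-- The squared norm of `P_n(· | y, ρ, q)`. -/
def ascNorm (ρ q : ℝ) (n : ℕ) : ℝ := qFactorial q n * qPochhammer (ρ ^ 2) q n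

theorem qFactorial_pos {q : ℝ} (hq : |q| < 1) (n : ℕ) : 0 < qFactorial q n := by
  have h := (Real.exp_pos _).trans_le (exp_neg_le_qPochhammer le_rfl hq hq n)
  rw [← qFactorial_mul_pow] at h
  exact pos_of_mul_pos_left h (pow_nonneg (by linarith [(abs_lt.1 hq).2]) n)

theorem ascNorm_pos {ρ q : ℝ} (hρ : |ρ| < 1) (hq : |q| < 1) (n : ℕ) : 0 < ascNorm ρ q n := by
  refine mul_pos (qFactorial_pos hq n) ((Real.exp_pos _).trans_le
    (exp_neg_le_qPochhammer (m := |ρ| ^ 2) (abs_pow ρ 2).le ?_ hq n))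
  exact pow_lt_one₀ (abs_nonneg ρ) hρ two_ne_zero

theorem exists_ascNorm_bound {q M : ℝ} (hq : |q| < 1) (hM0 : 0 ≤ M) (hM : M < 1) :
    ∃ c, 0 < c ∧ ∀ ρ, |ρ| ≤ M → ∀ n, c ≤ ascNorm ρ q n * (1 - q) ^ n := by
  refine ⟨_, mul_pos (Real.exp_pos (-(|q| / (1 - |q|) * (1 - |q|)⁻¹)))
    (Real.exp_pos (-(M ^ 2 / (1 - M ^ 2) * (1 - |q|)⁻¹))), fun ρ hρ n => ?_⟩
  have h1 := exp_neg_le_qPochhammer (le_refl |q|) hq hq n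
  have h2 := exp_neg_le_qPochhammer (a := ρ ^ 2) (m := M ^ 2) (by rw [abs_pow]; gcongr)
    (pow_lt_one₀ hM0 hM two_ne_zero) hq n
  have e : ascNorm ρ q n * (1 - q) ^ n = qPochhammer q q n * qPochhammer (ρ ^ 2) q n := by
    rw [← qFactorial_mul_pow, ascNorm]; ring
  rw [e]
  exact mul_le_mul h1 h2 (Real.exp_pos _).le ((Real.exp_pos _).le.trans h1)

theorem continuous_ascNorm (q : ℝ) (n : ℕ) : Continuous fun ρ => ascNorm ρ q n := by
  unfold ascNorm qPochhammer; fun_prop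

theorem abs_qNumber_le {q : ℝ} (hq : |q| < 1) (n : ℕ) : |qNumber q n| ≤ (1 - |q|)⁻¹ := by
  refine (Finset.abs_sum_le_sum_abs _ _).trans ?_
  simp only [abs_pow]
  exact geom_sum_le_inv (abs_nonneg q) hq n

/-! ### Absolute convergence of the kernel series. -/

theorem ascKernelTerm_eq (ρ₁ ρ q x y z : ℝ) (n : ℕ) :
    ascKernelTerm ρ₁ ρ q x y z n =
      ascP x y ρ q n / ascNorm ρ q n * (ρ₁ ^ n * ascP z y (ρ / ρ₁) q n) := by
  rw [ascKernelTerm, ascNorm]; ring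

/-- Geometric domination of the kernel terms, uniformly in the parameter. -/
theorem exists_ascKernel_bound {ρ₁ q x y z M : ℝ} (hρ₁ : |ρ₁| < 1) (hq : |q| < 1)
    (hx : x ∈ supportInterval q) (hz : z ∈ supportInterval q) (hM0 : 0 ≤ M) (hM : M < 1)
    (k : ℕ) : ∃ C t : ℝ, 0 ≤ t ∧ t < 1 ∧ ∀ ρ ρ', |ρ| ≤ M → |ρ'| ≤ M → ∀ n,
      |ascP x y ρ q (n + k) / ascNorm ρ q (n + k) * (ρ₁ ^ n * ascP z y (ρ' / ρ₁) q n)| ≤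
        C * t ^ n := by
  have hs : 0 < √(1 - q) := Real.sqrt_pos.2 (by linarith [(abs_lt.1 hq).2])
  have hs2 := Real.sq_sqrt (show 0 ≤ 1 - q by linarith [(abs_lt.1 hq).2])
  have ha0 := abs_nonneg ρ₁
  -- Each of the two polynomials contributes rⁿ; this r > 1 keeps |ρ₁| r² = 2|ρ₁|/(1+|ρ₁|) below 1.
  set r := √(2 / (1 + |ρ₁|)) with hrdef
  have hr2 : r ^ 2 = 2 / (1 + |ρ₁|) := Real.sq_sqrt (by positivity)
  have hr : 1 < r := by
    rw [hrdef, Real.lt_sqrt zero_le_one, one_pow, lt_div_iff₀ (by positivity)]; linarith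
  obtain ⟨C, hC, hCb⟩ := exists_ascP_bound (y := y) hq hx hM0 hr
  -- The ratio ρ'/ρ₁ may exceed 1 in modulus, which the growth bound allows.
  obtain ⟨C', hC', hCb'⟩ := exists_ascP_bound (y := y) hq hz
    (show 0 ≤ M / |ρ₁| by positivity) hr
  obtain ⟨c, hc, hcb⟩ := exists_ascNorm_bound hq hM0 hM
  set s := √(1 - q)
  refine ⟨C / c * (r * s) ^ k * C', |ρ₁| * r ^ 2, by positivity, ?_, fun ρ ρ' hρ hρ' n => ?_⟩
  · rw [hr2, ← mul_div_assoc, div_lt_one (by positivity)]; linarith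
  have hN := ascNorm_pos (hρ.trans_lt hM) hq (n + k)
  have h1 : |ascP x y ρ q (n + k) / ascNorm ρ q (n + k)| ≤ C / c * (r * s) ^ (n + k) := by
    rw [abs_div, abs_of_pos hN, div_le_iff₀ hN]
    have e1 := hCb ρ hρ (n + k)
    have e2 := hcb ρ hρ (n + k)
    rw [← hs2, ← pow_mul, mul_comm 2, pow_mul, sq] at e2
    set m := n + k
    have hsm : 0 < s ^ m := by positivity
    have e3 : |ascP x y ρ q m| * s ^ m * c ≤
        C * r ^ m * (ascNorm ρ q m * (s ^ m * s ^ m)) := by gcongr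
    have e4 : |ascP x y ρ q m| * c ≤ C * r ^ m * ascNorm ρ q m * s ^ m := by
      refine le_of_mul_le_mul_right ?_ hsm
      linarith
    rw [mul_pow, div_mul_eq_mul_div, div_mul_eq_mul_div, le_div_iff₀ hc]
    linarith
  have h2 : |ρ₁ ^ n * ascP z y (ρ' / ρ₁) q n| * s ^ n ≤ |ρ₁| ^ n * (C' * r ^ n) := by
    rw [abs_mul, abs_pow, mul_assoc]
    exact mul_le_mul_of_nonneg_left (hCb' _ (by rw [abs_div]; gcongr) n) (by positivity)
  rw [abs_mul]
  calc _ ≤ C / c * (r * s) ^ (n + k) * |ρ₁ ^ n * ascP z y (ρ' / ρ₁) q n| := by gcongr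
    _ = C / c * (r * s) ^ k * r ^ n * (|ρ₁ ^ n * ascP z y (ρ' / ρ₁) q n| * s ^ n) := by ring
    _ ≤ C / c * (r * s) ^ k * r ^ n * (|ρ₁| ^ n * (C' * r ^ n)) := by gcongr
    _ = _ := by ring

theorem summable_ascKernel {ρ₁ ρ ρ' q x y z : ℝ} (hρ₁ : |ρ₁| < 1) (hq : |q| < 1)
    (hx : x ∈ supportInterval q) (hz : z ∈ supportInterval q) (hρ : |ρ| < 1) (hρ' : |ρ'| < 1)
    (k : ℕ) (u : ℕ → ℝ) (B : ℝ) (hu : ∀ n, |u n| ≤ B) :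
    Summable fun n => u n *
      (ascP x y ρ q (n + k) / ascNorm ρ q (n + k) * (ρ₁ ^ n * ascP z y (ρ' / ρ₁) q n)) := by
  obtain ⟨C, t, ht0, ht1, hb⟩ := exists_ascKernel_bound (y := y) hρ₁ hq hx hz
    (le_max_of_le_left (abs_nonneg ρ) : 0 ≤ max |ρ| |ρ'|) (max_lt hρ hρ') k
  refine Summable.of_norm_bounded (g := fun n => B * (C * t ^ n))
    (((summable_geometric_of_lt_one ht0 ht1).mul_left C).mul_left B) fun n => ?_
  rw [Real.norm_eq_abs, abs_mul]
  exact mul_le_mul (hu n) (hb ρ ρ' (le_max_left _ _) (le_max_right _ _) n) (abs_nonneg _)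
    ((abs_nonneg _).trans (hu n))

theorem summable_ascKernelTerm {ρ₁ ρ q x z : ℝ} (y : ℝ) (hρ₁ : |ρ₁| < 1) (hq : |q| < 1)
    (hx : x ∈ supportInterval q) (hz : z ∈ supportInterval q) (hρ : |ρ| < 1) :
    Summable (ascKernelTerm ρ₁ ρ q x y z) := by
  refine (summable_ascKernel (y := y) hρ₁ hq hx hz hρ hρ 0 (fun _ => 1) 1 (by simp)).congr
    fun n => ?_
  rw [ascKernelTerm_eq, one_mul, add_zero]

/-! ### The functional equation relating ρ and ρq. -/

theorem one_sub_mul_pow_pos {a q : ℝ} (ha : |a| < 1) (hq : |q| < 1) (n : ℕ) :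
    0 < 1 - a * q ^ n := by
  have : |a * q ^ n| < 1 := by
    rw [abs_mul, abs_pow]
    exact (mul_le_of_le_one_right (abs_nonneg a) (pow_le_one₀ (abs_nonneg q) hq.le)).trans_lt ha
  linarith [(abs_lt.1 this).2]

theorem ascNorm_succ (ρ q : ℝ) (n : ℕ) :
    ascNorm ρ q (n + 1) = ascNorm ρ q n * (qNumber q (n + 1) * (1 - ρ ^ 2 * q ^ n)) := by
  simp only [ascNorm, qFactorial, qPochhammer, Finset.prod_range_succ]; ring

theorem ascNorm_shift (ρ q : ℝ) (n : ℕ) :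
    (1 - ρ ^ 2) * (1 - ρ ^ 2 * q) * ascNorm (ρ * q) q n =
      ascNorm ρ q n * ((1 - ρ ^ 2 * q ^ n) * (1 - ρ ^ 2 * q ^ (n + 1))) := by
  have h := qPochhammer_add_two (ρ ^ 2) q n
  have h' : qPochhammer (ρ ^ 2) q (n + 2) =
      qPochhammer (ρ ^ 2) q n * (1 - ρ ^ 2 * q ^ n) * (1 - ρ ^ 2 * q ^ (n + 1)) := by
    simp only [qPochhammer, Finset.prod_range_succ]
  rw [h'] at h
  simp only [ascNorm, mul_pow]
  linear_combination (-qFactorial q n) * h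

theorem ascKernelTerm_shift {ρ q : ℝ} (x y : ℝ) (hq : |q| < 1) (hρ : |ρ| < 1) (n : ℕ) :
    (1 - ρ ^ 2) * (1 - ρ ^ 2 * q) * (ascP x y ρ q n / ascNorm ρ q n
      - ρ * (1 - q) * y * qNumber q (n + 1) * (ascP x y ρ q (n + 1) / ascNorm ρ q (n + 1))
      + ρ ^ 2 * (1 - q) * qNumber q (n + 2) * qNumber q (n + 1) *
        (ascP x y ρ q (n + 2) / ascNorm ρ q (n + 2))) =
    kernelW q x y ρ * (ascP x y (ρ * q) q n / ascNorm (ρ * q) q n) := by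
  have hρq : |ρ * q| < 1 := by
    rw [abs_mul]; exact mul_lt_one_of_nonneg_of_lt_one_left (abs_nonneg _) hρ hq.le
  have hρ2 : |ρ ^ 2| < 1 := by rw [abs_pow]; exact pow_lt_one₀ (abs_nonneg ρ) hρ two_ne_zero
  have hq1 : q ≠ 1 := by rintro rfl; simp at hq
  rw [← mul_div_assoc (kernelW q x y ρ), kernelW_mul_ascP_shift x y ρ q hq1 n,
    eq_div_iff (ascNorm_pos hρq hq n).ne']
  have hu := (one_sub_mul_pow_pos hρ2 hq n).ne'
  have hv := (one_sub_mul_pow_pos hρ2 hq (n + 1)).ne'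
  have hN := (ascNorm_pos hρ hq n).ne'
  have hN2 := (ascNorm_pos hρ hq (n + 2)).ne'
  have e := ascNorm_shift ρ q n
  rw [ascNorm_succ ρ q (n + 1), ascNorm_succ ρ q n] at hN2
  rw [mul_right_comm, e, ascNorm_succ ρ q (n + 1), ascNorm_succ ρ q n]
  have h1 : qNumber q (n + 1) ≠ 0 := fun h => hN2 (by rw [h]; ring)
  have h2 : qNumber q (n + 1 + 1) ≠ 0 := fun h => hN2 (by rw [h]; ring)
  rw [show qNumber q (n + 2) = qNumber q (n + 1 + 1) from rfl]
  generalize ascNorm ρ q n = N at *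
  generalize qNumber q (n + 1) = a at *
  generalize qNumber q (n + 1 + 1) = b at *
  generalize 1 - ρ ^ 2 * q ^ n = u at *
  generalize 1 - ρ ^ 2 * q ^ (n + 1) = v at *
  field_simp

theorem ascKernel_shift {ρ₁ ρ q x z : ℝ} (y : ℝ) (hρ₁ : |ρ₁| < 1) (hρ₁0 : ρ₁ ≠ 0) (hq : |q| < 1)
    (hx : x ∈ supportInterval q) (hz : z ∈ supportInterval q) (hρ : |ρ| < 1) :
    (1 - ρ ^ 2) * (1 - ρ ^ 2 * q) * ∑' n, ascKernelTerm ρ₁ ρ q x y z n =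
      kernelW q x y ρ * ∑' n, ascKernelTerm ρ₁ (ρ * q) q x y z n := by
  have hρq : |ρ * q| < 1 := by
    rw [abs_mul]; exact mul_lt_one_of_nonneg_of_lt_one_left (abs_nonneg _) hρ hq.le
  have hq1 : q ≠ 1 := by rintro rfl; simp at hq
  set A : ℕ → ℝ := fun n => ascP x y ρ q n / ascNorm ρ q n with hA
  set S : ℕ → ℝ := fun n => ρ₁ ^ n * ascP z y (ρ * q / ρ₁) q n with hS
  have s0 : Summable fun n => A n * S n := by
    simpa using summable_ascKernel (y := y) hρ₁ hq hx hz hρ hρq 0 (fun _ => 1) 1 (by simp)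
  set f1 : ℕ → ℝ := fun n => ρ * (1 - q) * y * qNumber q (n + 1) * (A (n + 1) * S n) with hf1
  set f2 : ℕ → ℝ := fun n => ρ ^ 2 * (1 - q) * qNumber q (n + 2) * qNumber q (n + 1) *
    (A (n + 2) * S n) with hf2
  have s1 : Summable f1 := by
    refine summable_ascKernel (y := y) hρ₁ hq hx hz hρ hρq 1 _
      (|ρ * (1 - q) * y| * (1 - |q|)⁻¹) fun n => ?_
    rw [abs_mul _ (qNumber q (n + 1))]
    gcongr
    exact abs_qNumber_le hq _
  have s2 : Summable f2 := by
    refine summable_ascKernel (y := y) hρ₁ hq hx hz hρ hρq 2 _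
      (|ρ ^ 2 * (1 - q)| * (1 - |q|)⁻¹ * (1 - |q|)⁻¹) fun n => ?_
    rw [abs_mul _ (qNumber q (n + 1)), abs_mul _ (qNumber q (n + 2))]
    have := abs_qNumber_le hq (n + 1)
    have := abs_qNumber_le hq (n + 2)
    have : 0 < 1 - |q| := by linarith
    gcongr
  have hF := summable_ascKernelTerm (ρ₁ := ρ₁) y hρ₁ hq hx hz hρ
  have e0 : ascKernelTerm ρ₁ ρ q x y z 0 = A 0 * S 0 := by
    rw [ascKernelTerm_eq]; simp [hA, hS, ascP]
  have e1 : ascKernelTerm ρ₁ ρ q x y z 1 = A 1 * S 1 - f1 0 := by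
    rw [ascKernelTerm_eq]
    simp only [hA, hS, hf1, ascP, qNumber, zero_add, Finset.sum_range_one, pow_zero, pow_one]
    field_simp
    ring
  -- The powers of 1/ρ₁ in the connection coefficients are absorbed by ρ₁ⁿ⁺², leaving ρ₁ⁿ⁺¹ and ρ₁ⁿ
  -- with the lower polynomials.
  have e2 : ∀ n, ascKernelTerm ρ₁ ρ q x y z (n + 2) =
      A (n + 2) * S (n + 2) - f1 (n + 1) + f2 n := by
    intro n
    rw [ascKernelTerm_eq, ascP_eq_shift z y (ρ / ρ₁) q hq1 n,
      show ρ / ρ₁ * q = ρ * q / ρ₁ by ring]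
    simp only [hA, hS, hf1, hf2]
    field_simp
    ring
  have hsum : ∑' n, ascKernelTerm ρ₁ ρ q x y z n =
      ∑' n, (A n * S n) - ∑' n, f1 n + ∑' n, f2 n := by
    have s0' := (summable_nat_add_iff 2).2 s0
    have s1' := (summable_nat_add_iff 1).2 s1
    rw [← hF.sum_add_tsum_nat_add 2, ← s0.sum_add_tsum_nat_add 2, ← s1.sum_add_tsum_nat_add 1,
      tsum_congr e2, (s0'.sub s1').tsum_add s2, s0'.tsum_sub s1']
    simp only [Finset.sum_range_succ, Finset.sum_range_zero, e0, e1]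
    ring
  rw [hsum, ← s0.tsum_sub s1, ← (s0.sub s1).tsum_add s2, ← tsum_mul_left, ← tsum_mul_left]
  refine tsum_congr fun n => ?_
  rw [ascKernelTerm_eq]
  simp only [hA, hS, hf1, hf2]
  linear_combination (ρ₁ ^ n * ascP z y (ρ * q / ρ₁) q n) * ascKernelTerm_shift x y hq hρ n

/-! ### Iteration, passage to ρ = 0, and the infinite products. -/

theorem abs_mul_pow_le {ρ q : ℝ} (hq : |q| < 1) (n : ℕ) : |ρ * q ^ n| ≤ |ρ| := by
  rw [abs_mul, abs_pow]
  exact mul_le_of_le_one_right (abs_nonneg ρ) (pow_le_one₀ (abs_nonneg q) hq.le)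

theorem ascKernel_iterate {ρ₁ ρ q x z : ℝ} (y : ℝ) (hρ₁ : |ρ₁| < 1) (hρ₁0 : ρ₁ ≠ 0)
    (hq : |q| < 1) (hx : x ∈ supportInterval q) (hz : z ∈ supportInterval q) (hρ : |ρ| < 1)
    (N : ℕ) :
    qPochhammer (ρ ^ 2) q (2 * N) * ∑' n, ascKernelTerm ρ₁ ρ q x y z n =
      (∏ k ∈ Finset.range N, kernelW q x y (ρ * q ^ k)) *
        ∑' n, ascKernelTerm ρ₁ (ρ * q ^ N) q x y z n := by
  induction N with
  | zero => simp [qPochhammer]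
  | succ N ih =>
    have h := ascKernel_shift (ρ₁ := ρ₁) y hρ₁ hρ₁0 hq hx hz ((abs_mul_pow_le hq N).trans_lt hρ)
    have e : qPochhammer (ρ ^ 2) q (2 * (N + 1)) = qPochhammer (ρ ^ 2) q (2 * N) *
        ((1 - (ρ * q ^ N) ^ 2) * (1 - (ρ * q ^ N) ^ 2 * q)) := by
      rw [show 2 * (N + 1) = 2 * N + 1 + 1 by ring]
      simp only [qPochhammer, Finset.prod_range_succ]
      ring
    rw [Finset.prod_range_succ, pow_succ q N, ← mul_assoc ρ, mul_assoc (∏ k ∈ _, _), ← h, e]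
    linear_combination ((1 - (ρ * q ^ N) ^ 2) * (1 - (ρ * q ^ N) ^ 2 * q)) * ih

theorem tendsto_ascKernel {ρ₁ ρ q x z : ℝ} (y : ℝ) (hρ₁ : |ρ₁| < 1)
    (hq : |q| < 1) (hx : x ∈ supportInterval q) (hz : z ∈ supportInterval q) (hρ : |ρ| < 1) :
    Tendsto (fun N : ℕ => ∑' n, ascKernelTerm ρ₁ (ρ * q ^ N) q x y z n) atTop
      (𝓝 (∑' n, ascKernelTerm ρ₁ 0 q x y z n)) := by
  obtain ⟨C, t, ht0, ht1, hb⟩ := exists_ascKernel_bound (y := y) hρ₁ hq hx hz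
    (abs_nonneg ρ) hρ 0
  have h0 : Tendsto (fun N : ℕ => ρ * q ^ N) atTop (𝓝 0) := by
    simpa using (tendsto_pow_atTop_nhds_zero_of_abs_lt_one hq).const_mul ρ
  refine tendsto_tsum_of_dominated_convergence (bound := fun n => C * t ^ n)
    ((summable_geometric_of_lt_one ht0 ht1).mul_left C) (fun n => ?_)
    (Eventually.of_forall fun N n => ?_)
  · simp only [ascKernelTerm_eq]
    have c1 := (continuous_ascP x y q n).continuousAt (x := 0)
    have c2 := (continuous_ascNorm q n).continuousAt (x := 0)
    have c3 : ContinuousAt (fun ρ => ascP z y (ρ / ρ₁) q n) 0 :=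
      ((continuous_ascP z y q n).comp (continuous_id.div_const ρ₁)).continuousAt
    have c4 := (c1.div c2 (ascNorm_pos (by simp) hq n).ne').mul (c3.const_mul (ρ₁ ^ n))
    exact c4.tendsto.comp h0
  · rw [ascKernelTerm_eq, Real.norm_eq_abs]
    exact hb _ _ (abs_mul_pow_le hq N) (abs_mul_pow_le hq N) n

theorem summable_kernelW_sub_one {q : ℝ} (x y ρ : ℝ) (hq : |q| < 1) (hρ : |ρ| < 1) :
    Summable fun k : ℕ => kernelW q x y (ρ * q ^ k) - 1 := by
  refine Summable.of_norm_bounded (g := fun k : ℕ =>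
    (3 + 2 * |(1 - q) * (x * y)| + |(1 - q) * (x ^ 2 + y ^ 2)|) * (|ρ| * |q| ^ k))
    (((summable_geometric_of_lt_one (abs_nonneg q) hq).mul_left _).mul_left _) fun k => ?_
  have ht : |ρ * q ^ k| = |ρ| * |q| ^ k := by rw [abs_mul, abs_pow]
  have ht1 : |ρ * q ^ k| ≤ 1 := (abs_mul_pow_le hq k).trans hρ.le
  rw [← ht, Real.norm_eq_abs]
  generalize ρ * q ^ k = t at ht1
  have e : kernelW q x y t - 1 = ((t ^ 3 - 2 * t) - (1 - q) * (x * y) * (1 + t ^ 2) +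
    (1 - q) * (x ^ 2 + y ^ 2) * t) * t := by rw [kernelW]; ring
  rw [e, abs_mul]
  have ht2 : t ^ 2 ≤ 1 := (sq_le_one_iff_abs_le_one t).2 ht1
  have b1 : |t ^ 3 - 2 * t| ≤ 3 := by
    rw [show t ^ 3 - 2 * t = (t ^ 2 - 2) * t by ring, abs_mul]
    have : |t ^ 2 - 2| ≤ 3 := abs_le.2 ⟨by nlinarith, by linarith⟩
    nlinarith [abs_nonneg t]
  have b2 : |(1 - q) * (x * y) * (1 + t ^ 2)| ≤ 2 * |(1 - q) * (x * y)| := by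
    rw [abs_mul, abs_of_nonneg (by positivity : 0 ≤ 1 + t ^ 2)]
    nlinarith [abs_nonneg ((1 - q) * (x * y))]
  have b3 : |(1 - q) * (x ^ 2 + y ^ 2) * t| ≤ |(1 - q) * (x ^ 2 + y ^ 2)| := by
    rw [abs_mul _ t]; exact mul_le_of_le_one_right (abs_nonneg _) ht1
  refine mul_le_mul_of_nonneg_right ?_ (abs_nonneg t)
  exact (abs_add_le _ _).trans (add_le_add ((abs_sub _ _).trans (add_le_add b1 b2)) b3)

theorem multipliable_kernelW {q : ℝ} (x y ρ : ℝ) (hq : |q| < 1) (hρ : |ρ| < 1) :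
    Multipliable fun k : ℕ => kernelW q x y (ρ * q ^ k) := by
  simpa using Real.multipliable_one_add_of_summable (summable_kernelW_sub_one x y ρ hq hρ)

theorem tendsto_qPochhammer (a : ℝ) {q : ℝ} (hq : |q| < 1) :
    Tendsto (qPochhammer a q) atTop (𝓝 (qPochhammerInf a q)) :=
  (multipliable_qPochhammerInf a q hq).hasProd.tendsto_prod_nat

theorem qPochhammerInf_pos {a q : ℝ} (ha : |a| < 1) (hq : |q| < 1) : 0 < qPochhammerInf a q :=
  (Real.exp_pos _).trans_le (ge_of_tendsto (tendsto_qPochhammer a hq)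
    (Eventually.of_forall (exp_neg_le_qPochhammer le_rfl ha hq)))

theorem qPochhammerInf_mul_ascKernel {ρ₁ ρ q x z : ℝ} (y : ℝ) (hρ₁ : |ρ₁| < 1) (hρ₁0 : ρ₁ ≠ 0)
    (hq : |q| < 1) (hx : x ∈ supportInterval q) (hz : z ∈ supportInterval q) (hρ : |ρ| < 1) :
    qPochhammerInf (ρ ^ 2) q * ∑' n, ascKernelTerm ρ₁ ρ q x y z n =
      (∏' k : ℕ, kernelW q x y (ρ * q ^ k)) * ∑' n, ascKernelTerm ρ₁ 0 q x y z n := by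
  have h1 : Tendsto (fun N : ℕ => 2 * N) atTop atTop :=
    tendsto_id.const_mul_atTop' two_pos
  refine tendsto_nhds_unique
    (((tendsto_qPochhammer (ρ ^ 2) hq).comp h1).mul_const _) ?_
  simp only [Function.comp_apply, ascKernel_iterate y hρ₁ hρ₁0 hq hx hz hρ]
  exact (multipliable_kernelW x y ρ hq hρ).hasProd.tendsto_prod_nat.mul
    (tendsto_ascKernel y hρ₁ hq hx hz hρ)

/-- The Poisson–Mehler formula for the `q`-Hermite polynomials. -/
theorem prod_kernelW_mul_mehler {ρ₁ q x z : ℝ} (y : ℝ) (hρ₁ : |ρ₁| < 1) (hρ₁0 : ρ₁ ≠ 0)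
    (hq : |q| < 1) (hx : x ∈ supportInterval q) (hz : z ∈ supportInterval q) :
    (∏' k : ℕ, kernelW q x z (ρ₁ * q ^ k)) * ∑' n, ascKernelTerm ρ₁ 0 q x y z n =
      qPochhammerInf (ρ₁ ^ 2) q := by
  have e : ∑' n, ascKernelTerm ρ₁ 0 q x y z n = ∑' n, ascKernelTerm ρ₁ 0 q x z z n := by
    refine tsum_congr fun n => ?_
    simp only [ascKernelTerm, zero_div]
    rw [ascP_zero_param x y z, ascP_zero_param z y z]
  -- The general identity is used at y = z, ρ = ρ₁, where the series on its left side equals 1.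
  rw [e, ← qPochhammerInf_mul_ascKernel z hρ₁ hρ₁0 hq hx hz hρ₁, tsum_eq_single 0]
  · simp [ascKernelTerm, ascP, qFactorial, qPochhammer]
  · intro n hn
    obtain ⟨m, rfl⟩ := Nat.exists_eq_succ_of_ne_zero hn
    rw [ascKernelTerm, div_self hρ₁0, ascP_self_one, mul_zero]

/-- The quotient minus 1 is a summable difference over a denominator that stays above (1-|ρ₁|)⁴. -/
theorem multipliable_kernelW_div {ρ₁ ρ₂ q x z : ℝ} (y : ℝ) (hρ₁ : |ρ₁| < 1) (hρ₂ : |ρ₂| < 1)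
    (hq : |q| < 1) (hx : x ∈ supportInterval q) (hz : z ∈ supportInterval q) :
    Multipliable fun k : ℕ => kernelW q x y (ρ₂ * q ^ k) / kernelW q x z (ρ₁ * q ^ k) := by
  have hδ : 0 < (1 - |ρ₁|) ^ 4 := pow_pos (by linarith) 4
  have hW : ∀ k : ℕ, (1 - |ρ₁|) ^ 4 ≤ kernelW q x z (ρ₁ * q ^ k) := by
    intro k
    refine le_trans ?_ (kernelW_ge hq hx hz)
    have := abs_mul_pow_le (ρ := ρ₁) hq k
    have : 0 ≤ 1 - |ρ₁| := by linarith
    gcongr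
  have hs : Summable fun k : ℕ =>
      (kernelW q x y (ρ₂ * q ^ k) - kernelW q x z (ρ₁ * q ^ k)) / kernelW q x z (ρ₁ * q ^ k) := by
    have h := (summable_kernelW_sub_one x y ρ₂ hq hρ₂).sub
      (summable_kernelW_sub_one x z ρ₁ hq hρ₁)
    refine Summable.of_norm_bounded (h.abs.div_const ((1 - |ρ₁|) ^ 4)) fun k => ?_
    rw [norm_div, Real.norm_eq_abs, Real.norm_eq_abs, abs_of_pos (hδ.trans_le (hW k)),
      sub_sub_sub_cancel_right]
    gcongr
    exact hW k
  refine (Real.multipliable_one_add_of_summable hs).congr fun k => ?_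
  rw [sub_div, div_self (hδ.trans_le (hW k)).ne']
  ring

theorem mainTheorem1 (ρ₁ ρ₂ q x y z : ℝ)
    (hρ₁ : |ρ₁| < 1) (hρ₁0 : ρ₁ ≠ 0) (hρ₂ : |ρ₂| < 1) (hq : |q| < 1)
    (hx : x ∈ supportInterval q) (hy : y ∈ supportInterval q) (hz : z ∈ supportInterval q) :
    Multipliable (fun k : ℕ => kernelW q x y (ρ₂ * q ^ k) / kernelW q x z (ρ₁ * q ^ k)) ∧
    HasSum (ascKernelTerm ρ₁ ρ₂ q x y z)
      (qPochhammerInf (ρ₁ ^ 2) q / qPochhammerInf (ρ₂ ^ 2) q *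
        ∏' k : ℕ, kernelW q x y (ρ₂ * q ^ k) / kernelW q x z (ρ₁ * q ^ k)) ∧
    0 ≤ ∑' n : ℕ, ascKernelTerm ρ₁ ρ₂ q x y z n := by
  have hm := multipliable_kernelW_div y hρ₁ hρ₂ hq hx hz
  have hsq : ∀ {a : ℝ}, |a| < 1 → |a ^ 2| < 1 := fun {a} ha => by
    rw [abs_pow]; exact pow_lt_one₀ (abs_nonneg a) ha two_ne_zero
  have p1 := qPochhammerInf_pos (hsq hρ₁) hq
  have p2 := qPochhammerInf_pos (hsq hρ₂) hq
  have hF := qPochhammerInf_mul_ascKernel y hρ₁ hρ₁0 hq hx hz hρ₂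
  have hG := prod_kernelW_mul_mehler y hρ₁ hρ₁0 hq hx hz
  -- If this product vanished, the Mehler identity would force (ρ₁²)_∞ = 0.
  have hW0 : ∏' k : ℕ, kernelW q x z (ρ₁ * q ^ k) ≠ 0 := by
    intro h; rw [h, zero_mul] at hG; exact p1.ne hG
  have hdiv : ∏' k : ℕ, kernelW q x y (ρ₂ * q ^ k) / kernelW q x z (ρ₁ * q ^ k) =
      (∏' k : ℕ, kernelW q x y (ρ₂ * q ^ k)) / ∏' k : ℕ, kernelW q x z (ρ₁ * q ^ k) := by
    refine tendsto_nhds_unique hm.hasProd.tendsto_prod_nat ?_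
    simp only [Finset.prod_div_distrib]
    exact (multipliable_kernelW x y ρ₂ hq hρ₂).hasProd.tendsto_prod_nat.div
      (multipliable_kernelW x z ρ₁ hq hρ₁).hasProd.tendsto_prod_nat hW0
  have hval : ∑' n, ascKernelTerm ρ₁ ρ₂ q x y z n =
      qPochhammerInf (ρ₁ ^ 2) q / qPochhammerInf (ρ₂ ^ 2) q *
        ∏' k : ℕ, kernelW q x y (ρ₂ * q ^ k) / kernelW q x z (ρ₁ * q ^ k) := by
    rw [hdiv, ← hG]
    field_simp
    linear_combination hF
  have hnn : ∀ {ρ u : ℝ}, u ∈ supportInterval q → ∀ k : ℕ, 0 ≤ kernelW q x u (ρ * q ^ k) :=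
    fun hu k => (by positivity : (0 : ℝ) ≤ _).trans (kernelW_ge hq hx hu)
  refine ⟨hm, hval ▸ (summable_ascKernelTerm y hρ₁ hq hx hz hρ₂).hasSum, ?_⟩
  rw [hval]
  refine mul_nonneg (div_nonneg p1.le p2.le) ?_
  exact ge_of_tendsto hm.hasProd.tendsto_prod_nat (Eventually.of_forall fun N =>
    Finset.prod_nonneg fun k _ => div_nonneg (hnn hy k) (hnn hz k))
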